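/- Let $n\ge 0$ be an integer, let $f:\mathbb N\times\mathbb R^n\to\mathbb R^n$, $\mathbb N=\{0,1,2,\dots\}$, be $C^1$ in its second variable with Jacobian $J(k,x)=\frac{\partial}{\partial x}f(k,x)$, and let $\Omega\subset\mathbb R^n$ be a compact convex set such that every solution of $$x(k+1)=f(k,x(k)),\qquad k\in\mathbb N,\qquad (1)$$ with $x(0)\in\Omega$ satisfies $x(k)\in\Omega$ for all $k\in\mathbb N$. Let $T\ge 1$ be an integer with $f(k+T,a)=f(k,a)$ for all $k\in\mathbb N$ and $a\in\Omega$. For $k\in\mathbb N$ and $a,b\in\Omega$ put $$F(k,a,b)=\int_0^1 J(k,ra+(1-r)b)\,dr .$$ A real matrix is called TN (TP) if all its minors are nonnegative (positive). A square matrix $A$ is called oscillatory if it is TN and $A^m$ is TP for some integer $m\ge1$. A linear system $z(k+1)=A(k)z(k)$ with $A:\mathbb N\to\mathbb R^{n\times n}$ is called an oscillatory discrete-time system (ODTS) of order $p\ge1$ if $A(k)$ is oscillatory for all $k\in\mathbb N$ and every product $A(k_p)\cdots A(k_2)A(k_1)$ with $0\le k_1<k_2<\dots<k_p$ is TP. 1.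 Let $h\ge1$ be an integer such that the variational system of (1) is an ODTS of order $h$; that is, for any two solutions $x,y$ of (1) with $x(0),y(0)\in\Omega$, the linear system $z(k+1)=F(k,x(k),y(k))\,z(k)$ is an ODTS of order $h$. (In particular, this holds if $z(k+1)=F(k,a_k,b_k)z(k)$ is an ODTS of order $h$ for all sequences $(a_k),(b_k)$ in $\Omega$.) Then every solution of (1) emanating from $\Omega$ converges to an $hT$-periodic solution of (1): for every solution $x$ with $x(0)\in\Omega$ there is a solution $y$ of (1) with $y(k)\in\Omega$ and $y(k+hT)=y(k)$ for all $k\in\mathbb N$, and $x(k)-y(k)\to0$ as $k\to\infty$. 2. In particular, if $n\ge2$ and $F(k,a,b)$ is oscillatory for all $k\in\mathbb N$ and all $a,b\in\Omega$, then every solution of (1) emanating from $\Omega$ converges, in the same sense, to an $(n-1)T$-periodic solution of (1). -/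

import Mathlib

open Filter Topology

namespace OscSys

/-- A real matrix is totally nonnegative (TN) if all its minors are nonnegative. The row and column
selections `r`, `c` are strictly increasing. -/
def IsTN {m n : ℕ} (A : Matrix (Fin m) (Fin n) ℝ) : Prop :=
  ∀ (k : ℕ) (r : Fin k ↪o Fin m) (c : Fin k ↪o Fin n), 0 ≤ (A.submatrix r c).det

/-- A real matrix is totally positive (TP) if all its minors are positive. -/
def IsTP {m n : ℕ} (A : Matrix (Fin m) (Fin n) ℝ) : Prop :=
  ∀ (k : ℕ) (r : Fin k ↪o Fin m) (c : Fin k ↪o Fin n), 0 < (A.submatrix r c).det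

/-- A square matrix is oscillatory if it is TN and some positive power of it is TP. -/
def IsOscillatory {n : ℕ} (A : Matrix (Fin n) (Fin n) ℝ) : Prop :=
  IsTN A ∧ ∃ k : ℕ, 0 < k ∧ IsTP (A ^ k)

/-- The linear time-varying system `y (k+1) = A k *ᵥ y k` is an oscillatory discrete-time system
of order `p`: every `A k` is oscillatory, and every product `A (t p) * ⋯ * A (t 2) * A (t 1)` with
times `t 1 < t 2 < ⋯ < t p` is TP. -/
def IsODTS {n : ℕ} (p : ℕ) (A : ℕ → Matrix (Fin n) (Fin n) ℝ) : Prop :=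
  (∀ k, IsOscillatory (A k)) ∧
    ∀ t : Fin p → ℕ, StrictMono t → IsTP (List.ofFn fun i => A (t i)).reverse.prod

/-- `x` is a solution of the difference equation `x (k+1) = f k (x k)`. -/
def IsSolution {n : ℕ} (f : ℕ → (Fin n → ℝ) → (Fin n → ℝ)) (x : ℕ → (Fin n → ℝ)) : Prop :=
  ∀ k, x (k + 1) = f k (x k)

/-- The Jacobian matrix of `f k` at `x`. -/
noncomputable def jacobian {n : ℕ} (f : ℕ → (Fin n → ℝ) → (Fin n → ℝ)) (k : ℕ)
    (x : Fin n → ℝ) : Matrix (Fin n) (Fin n) ℝ :=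
  LinearMap.toMatrix' (fderiv ℝ (f k) x : (Fin n → ℝ) →ₗ[ℝ] (Fin n → ℝ))

/-- The line integral of the Jacobian, `F(k,a,b) = ∫₀¹ J(k, r a + (1 - r) b) dr`, taken entrywise. -/
noncomputable def lineIntegral {n : ℕ} (f : ℕ → (Fin n → ℝ) → (Fin n → ℝ)) (k : ℕ)
    (a b : Fin n → ℝ) : Matrix (Fin n) (Fin n) ℝ :=
  Matrix.of fun i j => ∫ r in (0 : ℝ)..1, jacobian f k (r • a + (1 - r) • b) i j

/-- The variational system is an ODTS of order `h`: for any two solutions `x`, `y` emanating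
from `Ω`, the linear system `z (k+1) = F(k, x k, y k) z k`, which governs `z = x - y`, is an ODTS
of order `h`. When solutions stay in `Ω`, this holds as soon as
`z (k+1) = F(k, a k, b k) z k` is an ODTS of order `h` for all sequences `a`, `b` in `Ω`. -/
def VariationalSystemIsODTS {n : ℕ} (f : ℕ → (Fin n → ℝ) → (Fin n → ℝ))
    (Ω : Set (Fin n → ℝ)) (h : ℕ) : Prop :=
  ∀ x y : ℕ → (Fin n → ℝ), IsSolution f x → IsSolution f y → x 0 ∈ Ω → y 0 ∈ Ω →
    IsODTS h fun k => lineIntegral f k (x k) (y k)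

/-- Every solution emanating from `Ω` converges to a `u`-periodic solution in `Ω`. -/
def SolutionsConvergeToPeriodic {n : ℕ} (f : ℕ → (Fin n → ℝ) → (Fin n → ℝ))
    (Ω : Set (Fin n → ℝ)) (u : ℕ) : Prop :=
  ∀ x : ℕ → (Fin n → ℝ), IsSolution f x → x 0 ∈ Ω →
    ∃ y : ℕ → (Fin n → ℝ), IsSolution f y ∧ (∀ k, y k ∈ Ω) ∧ Function.Periodic y u ∧
      Tendsto (fun k => x k - y k) atTop (𝓝 0)

end OscSys

namespace OscSys

open Matrix Finset

/-! The difference `z` of two solutions in `Ω` obeys a linear system with matrices `F(k, x k, y k)`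
(`lineIntegral_mulVec_sub`). Any `h` consecutive ones multiply to a TP matrix, and TP matrices
diminish sign variation (`IsTP.weakVar_mulVec_le`), so along multiples of `h` the integers `weakVar
z` and `weakVar (-z)` decrease and become constant. Which of the two limits is larger decides the
sign of the first coordinate of `z`, so that sign is eventually constant and nonzero
(`eventually_sign_const`).

For an orbit of the map over `h * T` steps and its own shift, this makes the first coordinate
eventually monotone, hence convergent. Every point of the orbit of a cluster point then has that
limit as first coordinate, and two distinct points cannot share this property. So the cluster point
is unique and fixed, and the orbit converges to it (`exists_tendsto_fixed`).

The compounds of an oscillatory matrix are nonnegative, with positive diagonal and a positive power,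
so each factor of a product enlarges supports and all long enough products are TP
(`exists_isTP_list_prod`). The first claim then applies with two consecutive orders. Both limits
coincide, so the limit has period `T`, and a fortiori period `(n - 1) * T`. -/

/-! ### Cauchy–Binet formula -/

/-- The determinant of a product, expanded multilinearly in the columns of the right factor. -/
theorem det_mul_eq_sum {κ ι R : Type*} [Fintype κ] [DecidableEq κ] [Fintype ι] [CommRing R]
    (A : Matrix κ ι R) (B : Matrix ι κ R) :
    (A * B).det = ∑ p : κ → ι, (∏ l, B (p l) l) * (A.submatrix id p).det := by
  classical
  simp only [det_apply', mul_apply, prod_univ_sum, mul_sum, Fintype.piFinset_univ]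
  rw [Finset.sum_comm]
  refine sum_congr rfl fun p _ => sum_congr rfl fun σ _ => ?_
  simp only [prod_mul_distrib, submatrix_apply, id_eq]
  ring

/-- Sorting factors an injection uniquely through its image set. This groups the injective terms of
the column expansion by image, as Cauchy–Binet requires. -/
theorem bijective_orderEmb_comp_perm (k n : ℕ) :
    Function.Bijective (fun q : (Fin k ↪o Fin n) × Equiv.Perm (Fin k) =>
      (⟨q.1 ∘ q.2, q.1.injective.comp q.2.injective⟩ :
        {p : Fin k → Fin n // Function.Injective p})) := by
  constructor
  · rintro ⟨s, σ⟩ ⟨s', σ'⟩ h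
    have h : s ∘ σ = s' ∘ σ' := congrArg Subtype.val h
    have hr : Set.range s = Set.range s' := by
      rw [← σ.surjective.range_comp s, h, σ'.surjective.range_comp]
    have hs : s = s' := DFunLike.coe_injective ((s.strictMono.range_inj s'.strictMono).1 hr)
    subst hs
    have : σ = σ' := Equiv.ext fun i => s.injective (congrFun h i)
    rw [this]
  · rintro ⟨p, hp⟩
    have hm : StrictMono (p ∘ Tuple.sort p) :=
      (Tuple.monotone_sort p).strictMono_of_injective (hp.comp (Tuple.sort p).injective)
    refine ⟨⟨OrderEmbedding.ofStrictMono _ hm, (Tuple.sort p)⁻¹⟩, Subtype.ext ?_⟩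
    funext i
    simp

/-- The **Cauchy–Binet formula**. -/
theorem det_mul_eq_sum_orderEmb {k n : ℕ} (A : Matrix (Fin k) (Fin n) ℝ)
    (B : Matrix (Fin n) (Fin k) ℝ) :
    (A * B).det =
      ∑ s : Fin k ↪o Fin n, (A.submatrix id s).det * (B.submatrix s id).det := by
  classical
  rw [det_mul_eq_sum]
  have h1 : ∑ p : Fin k → Fin n, (∏ l, B (p l) l) * (A.submatrix id p).det =
      ∑ p : {p : Fin k → Fin n // Function.Injective p},
        (∏ l, B (p.1 l) l) * (A.submatrix id p.1).det := by
    rw [← Finset.sum_subtype (univ.filter fun p : Fin k → Fin n => Function.Injective p)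
      (fun p => by simp) (fun p => (∏ l, B (p l) l) * (A.submatrix id p).det)]
    refine (sum_subset (filter_subset _ _) fun p _ hp => ?_).symm
    have hp : ¬ Function.Injective p := by simpa using hp
    simp only [Function.Injective, not_forall] at hp
    obtain ⟨i, j, hij, hne⟩ := hp
    rw [det_zero_of_column_eq hne (fun l => by simp [hij]), mul_zero]
  rw [h1, ← (bijective_orderEmb_comp_perm k n).sum_comp, Fintype.sum_prod_type]
  refine sum_congr rfl fun s _ => ?_
  rw [det_apply' (B.submatrix s id), mul_sum]
  refine sum_congr rfl fun σ _ => ?_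
  have h2 : (A.submatrix id (s ∘ σ)) = (A.submatrix id s).submatrix id σ := rfl
  rw [h2, det_permute']
  simp only [Function.comp, submatrix_apply, id_eq]
  ring

/-! ### Elimination and principal minors of TN matrices -/

/-- One step of Gaussian elimination in the top left corner. -/
theorem det_eq_corner_mul_det {k : ℕ} (A : Matrix (Fin (k + 1)) (Fin (k + 1)) ℝ)
    (h : A 0 0 ≠ 0) :
    A.det = A 0 0 *
      (Matrix.of fun i j : Fin k =>
        A i.succ j.succ - A i.succ 0 * A 0 j.succ / A 0 0).det := by
  set B : Matrix (Fin (k + 1)) (Fin (k + 1)) ℝ := Matrix.of fun i j =>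
    if i = 0 then A i j else A i j - A i 0 * A 0 j / A 0 0 with hB
  have h1 : A.det = B.det := by
    refine det_eq_of_forall_row_eq_smul_add_const
      (fun i => if i = 0 then 0 else A i 0 / A 0 0) 0 (by simp) fun i j => ?_
    by_cases hi : i = 0
    · simp [hB, hi]
    · simp only [hB, of_apply, if_neg hi, if_true]
      ring
  rw [h1, det_succ_column_zero, Fin.sum_univ_succ, sum_eq_zero, add_zero]
  · simp only [hB, of_apply, Fin.val_zero, pow_zero, one_mul, if_true]
    congr 2
  · intro i _
    have : B i.succ 0 = 0 := by
      simp only [hB, of_apply, if_neg (Fin.succ_ne_zero i)]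
      field_simp
      ring
    rw [this, mul_zero, zero_mul]

theorem IsTN.submatrix {m n m' n' : ℕ} {A : Matrix (Fin m) (Fin n) ℝ} (hA : IsTN A)
    (r : Fin m' ↪o Fin m) (c : Fin n' ↪o Fin n) : IsTN (A.submatrix r c) :=
  fun k r' c' => hA k (r'.trans r) (c'.trans c)

theorem IsTN.nonneg {m n : ℕ} {A : Matrix (Fin m) (Fin n) ℝ} (hA : IsTN A) (i : Fin m)
    (j : Fin n) : 0 ≤ A i j := by
  have := hA 1 (OrderEmbedding.ofStrictMono (fun _ => i) (Subsingleton.strictMono _))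
    (OrderEmbedding.ofStrictMono (fun _ => j) (Subsingleton.strictMono _))
  simpa using this

theorem IsTN.det_nonneg {n : ℕ} {A : Matrix (Fin n) (Fin n) ℝ} (hA : IsTN A) : 0 ≤ A.det :=
  hA n (RelEmbedding.refl _) (RelEmbedding.refl _)

theorem det_submatrix_rev {k m n : ℕ} (A : Matrix (Fin m) (Fin n) ℝ) (r : Fin k → Fin m)
    (c : Fin k → Fin n) :
    ((A.submatrix Fin.rev Fin.rev).submatrix r c).det =
      (A.submatrix (Fin.rev ∘ r ∘ Fin.rev) (Fin.rev ∘ c ∘ Fin.rev)).det := by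
  rw [← det_submatrix_equiv_self Fin.revPerm]
  rfl

theorem strictMono_rev_comp {k n : ℕ} {r : Fin k → Fin n} (hr : StrictMono r) :
    StrictMono (Fin.rev ∘ r ∘ Fin.rev) := fun i j hij => by
  simpa using hr (Fin.rev_lt_rev.2 hij)

theorem IsTN.reverse {m n : ℕ} {A : Matrix (Fin m) (Fin n) ℝ} (hA : IsTN A) :
    IsTN (A.submatrix Fin.rev Fin.rev) := fun k r c => by
  rw [det_submatrix_rev]
  exact hA k (OrderEmbedding.ofStrictMono _ (strictMono_rev_comp r.strictMono))
    (OrderEmbedding.ofStrictMono _ (strictMono_rev_comp c.strictMono))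

theorem strictMono_cons_zero_succ {k n : ℕ} {r : Fin k → Fin n} (hr : StrictMono r) :
    StrictMono (Fin.cons 0 (Fin.succ ∘ r) : Fin (k + 1) → Fin (n + 1)) := by
  rw [Fin.strictMono_iff_lt_succ]
  intro i
  cases k with
  | zero => exact i.elim0
  | succ k =>
    refine Fin.cases ?_ (fun i => ?_) i
    · simp
    · rw [Fin.cons_succ, ← Fin.succ_castSucc, Fin.cons_succ]
      exact Fin.succ_lt_succ_iff.2 (hr (Fin.castSucc_lt_succ))

/-- The Schur complement of the top left corner of a TN matrix is TN. -/
theorem IsTN.schur {m n : ℕ} {A : Matrix (Fin (m + 1)) (Fin (n + 1)) ℝ} (hA : IsTN A)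
    (h : 0 < A 0 0) :
    IsTN (Matrix.of fun (i : Fin m) (j : Fin n) =>
      A i.succ j.succ - A i.succ 0 * A 0 j.succ / A 0 0) := fun k r c => by
  have h1 := hA (k + 1) (OrderEmbedding.ofStrictMono _ (strictMono_cons_zero_succ r.strictMono))
    (OrderEmbedding.ofStrictMono _ (strictMono_cons_zero_succ c.strictMono))
  rw [det_eq_corner_mul_det _ (by simpa using h.ne')] at h1
  simp only [submatrix_apply, OrderEmbedding.coe_ofStrictMono, Fin.cons_zero, Fin.cons_succ,
    Function.comp] at h1
  exact nonneg_of_mul_nonneg_right h1 h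

/-- If the corner vanished, each 2×2 minor through it would be minus a product of an entry of the
first row and one of the first column; nonnegativity then kills that whole row or column. -/
theorem IsTN.corner_pos {n : ℕ} {A : Matrix (Fin (n + 1)) (Fin (n + 1)) ℝ} (hA : IsTN A)
    (hdet : 0 < A.det) : 0 < A 0 0 := by
  refine (hA.nonneg 0 0).lt_of_ne' fun h0 => hdet.ne' ?_
  have key : ∀ i j : Fin n, A 0 j.succ * A i.succ 0 = 0 := by
    intro i j
    have := hA 2
      (OrderEmbedding.ofStrictMono ![0, i.succ] (by simp [Fin.strictMono_iff_lt_succ]))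
      (OrderEmbedding.ofStrictMono ![0, j.succ] (by simp [Fin.strictMono_iff_lt_succ]))
    rw [det_fin_two] at this
    simp [h0] at this
    exact le_antisymm this (mul_nonneg (hA.nonneg _ _) (hA.nonneg _ _))
  by_cases hrow : ∀ j : Fin n, A 0 j.succ = 0
  · exact det_eq_zero_of_row_eq_zero 0 (Fin.cases h0 hrow)
  · push Not at hrow
    obtain ⟨j, hj⟩ := hrow
    exact det_eq_zero_of_column_eq_zero 0
      (Fin.cases h0 fun i => (mul_eq_zero.1 (key i j)).resolve_left hj)

/-- Deleting an index other than 0 commutes with taking the Schur complement of the corner, so the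
induction hypothesis applies to the complement. -/
theorem IsTN.det_remove_succ_pos {n : ℕ} (ih : ∀ A : Matrix (Fin (n + 1)) (Fin (n + 1)) ℝ,
      IsTN A → 0 < A.det → ∀ i : Fin (n + 1), 0 < (A.submatrix i.succAbove i.succAbove).det)
    {A : Matrix (Fin (n + 2)) (Fin (n + 2)) ℝ} (hA : IsTN A) (hdet : 0 < A.det)
    (i : Fin (n + 1)) : 0 < (A.submatrix i.succ.succAbove i.succ.succAbove).det := by
  have h0 := hA.corner_pos hdet
  have h1 := det_eq_corner_mul_det A h0.ne'
  have h2 := ih _ (hA.schur h0) (pos_of_mul_pos_right (h1 ▸ hdet) h0.le) i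
  rw [det_eq_corner_mul_det _ (by simpa using h0.ne')]
  simp only [submatrix_apply, Fin.succ_succAbove_zero, Fin.succ_succAbove_succ]
  exact mul_pos h0 h2

/-- Deleting a row and the corresponding column from a nonsingular TN matrix leaves it
nonsingular. -/
theorem IsTN.det_remove_pos {n : ℕ} : ∀ {A : Matrix (Fin (n + 1)) (Fin (n + 1)) ℝ}, IsTN A →
    0 < A.det → ∀ i : Fin (n + 1), 0 < (A.submatrix i.succAbove i.succAbove).det := by
  induction n with
  | zero => intro A _ _ i; simp
  | succ n ih =>
    intro A hA hdet i
    refine Fin.cases ?_ (fun i => ?_) i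
    -- Index 0 is the pivot and cannot be deleted this way; reversing both orders preserves TN and
    -- turns it into the last index.
    · have h1 : 0 < (A.submatrix Fin.rev Fin.rev).det := by
        have := det_submatrix_equiv_self Fin.revPerm A
        rw [← this] at hdet
        exact hdet
      have h2 := IsTN.det_remove_succ_pos (fun A hA => ih hA) hA.reverse h1 (Fin.last n)
      rw [det_submatrix_rev] at h2
      convert h2 using 3
      all_goals
        funext j
        simp [Fin.rev_castSucc]
    · exact IsTN.det_remove_succ_pos (fun A hA => ih hA) hA hdet i

/-- The principal minors of a nonsingular TN matrix are positive. -/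
theorem IsTN.principal_minor_pos {n : ℕ} : ∀ {A : Matrix (Fin n) (Fin n) ℝ}, IsTN A →
    0 < A.det → ∀ {k : ℕ} (s : Fin k ↪o Fin n), 0 < (A.submatrix s s).det := by
  induction n with
  | zero =>
    intro A _ _ k s
    have : IsEmpty (Fin k) := ⟨fun i => (s i).elim0⟩
    simp
  | succ n ih =>
    intro A hA hdet k s
    by_cases hs : Function.Surjective s
    · have := det_submatrix_equiv_self (Equiv.ofBijective s ⟨s.injective, hs⟩) A
      rw [← this] at hdet
      exact hdet
    · simp only [Function.Surjective, not_forall, not_exists] at hs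
      obtain ⟨i, hi⟩ := hs
      choose t ht using fun j => Fin.exists_succAbove_eq (hi j)
      have htm : StrictMono t := fun a b hab => by
        rw [← (Fin.strictMono_succAbove i).lt_iff_lt, ht, ht]
        exact s.strictMono hab
      have h1 := ih (hA.submatrix (Fin.succAboveOrderEmb i) (Fin.succAboveOrderEmb i))
        (hA.det_remove_pos hdet i) (OrderEmbedding.ofStrictMono t htm)
      convert h1 using 2
      ext a b
      simp [ht]

/-! ### Compounds, and total positivity of long products of oscillatory matrices -/

/-- The `k`-th multiplicative compound: the matrix of all minors of order `k`. -/
def compound (k : ℕ) {n : ℕ} (A : Matrix (Fin n) (Fin n) ℝ) :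
    Matrix (Fin k ↪o Fin n) (Fin k ↪o Fin n) ℝ :=
  Matrix.of fun r c => (A.submatrix r c).det

theorem compound_mul (k : ℕ) {n : ℕ} (A B : Matrix (Fin n) (Fin n) ℝ) :
    compound k (A * B) = compound k A * compound k B := by
  ext r c
  have h : (A * B).submatrix r c = A.submatrix r id * B.submatrix id c := by
    ext i j
    simp [mul_apply]
  simp only [compound, of_apply, mul_apply]
  rw [h, det_mul_eq_sum_orderEmb]
  rfl

theorem compound_one (k n : ℕ) :
    compound k (1 : Matrix (Fin n) (Fin n) ℝ) = 1 := by
  ext r c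
  by_cases h : r = c
  · subst h
    simp [compound, submatrix_one r r.injective]
  · rw [one_apply_ne h]
    have : ∃ i, ∀ j, r i ≠ c j := by
      by_contra! hc
      refine h (DFunLike.coe_injective ((r.strictMono.range_inj c.strictMono).1 ?_))
      have hs : univ.map r.toEmbedding ⊆ univ.map c.toEmbedding := by
        intro x hx
        obtain ⟨i, -, rfl⟩ := Finset.mem_map.1 hx
        obtain ⟨j, hj⟩ := hc i
        exact Finset.mem_map.2 ⟨j, Finset.mem_univ _, hj.symm⟩
      have := congrArg (fun s : Finset (Fin n) => (s : Set (Fin n)))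
        (Finset.eq_of_subset_of_card_le hs (by simp))
      simpa using this
    obtain ⟨i, hi⟩ := this
    exact det_eq_zero_of_row_eq_zero i fun j => by simp [one_apply_ne (hi j)]

/-- The compound as a monoid homomorphism. -/
def compoundHom (k n : ℕ) :
    Matrix (Fin n) (Fin n) ℝ →* Matrix (Fin k ↪o Fin n) (Fin k ↪o Fin n) ℝ where
  toFun := compound k
  map_one' := compound_one k n
  map_mul' := compound_mul k

theorem IsTP.det_pos {n : ℕ} {A : Matrix (Fin n) (Fin n) ℝ} (hA : IsTP A) : 0 < A.det :=
  hA n (RelEmbedding.refl _) (RelEmbedding.refl _)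

theorem IsOscillatory.det_pos {n : ℕ} {A : Matrix (Fin n) (Fin n) ℝ} (hA : IsOscillatory A) :
    0 < A.det := by
  obtain ⟨hTN, m, hm, hTP⟩ := hA
  refine hTN.det_nonneg.lt_of_ne' fun h => ?_
  have := hTP.det_pos
  rw [det_pow, h, zero_pow hm.ne'] at this
  exact this.false

/-- A nonnegative matrix with positive diagonal, some power of which is positive. -/
def IsPrimitiveDiag {ι : Type*} [Fintype ι] [DecidableEq ι] (A : Matrix ι ι ℝ) : Prop :=
  (∀ i j, 0 ≤ A i j) ∧ (∀ i, 0 < A i i) ∧ ∃ m : ℕ, ∀ i j, 0 < (A ^ m) i j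

theorem IsOscillatory.compound {n : ℕ} {A : Matrix (Fin n) (Fin n) ℝ} (hA : IsOscillatory A)
    (k : ℕ) : IsPrimitiveDiag (compoundHom k n A) := by
  refine ⟨fun r c => hA.1 k r c, fun r => hA.1.principal_minor_pos hA.det_pos r, ?_⟩
  obtain ⟨m, -, hm⟩ := hA.2
  refine ⟨m, fun r c => ?_⟩
  rw [← map_pow]
  exact hm k r c

theorem mulVec_nonneg_of_nonneg {ι : Type*} [Fintype ι] {A : Matrix ι ι ℝ} (hA : ∀ i j, 0 ≤ A i j) {v : ι → ℝ}
    (hv : ∀ i, 0 ≤ v i) (i : ι) : 0 ≤ (A *ᵥ v) i :=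
  sum_nonneg fun j _ => mul_nonneg (hA i j) (hv j)

theorem mulVec_pos_of_entry_pos {ι : Type*} [Fintype ι] {A : Matrix ι ι ℝ} (hA : ∀ i j, 0 ≤ A i j) {v : ι → ℝ}
    (hv : ∀ i, 0 ≤ v i) {i j : ι} (hij : 0 < A i j) (hj : 0 < v j) : 0 < (A *ᵥ v) i :=
  sum_pos' (fun j _ => mul_nonneg (hA i j) (hv j)) ⟨j, mem_univ _, mul_pos hij hj⟩

section Primitive

variable {ι : Type*} [Fintype ι] [DecidableEq ι]

/-- A matrix that is nonnegative and primitive with positive diagonal enlarges the support of a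
nonnegative vector. -/
theorem IsPrimitiveDiag.card_support_lt {A : Matrix ι ι ℝ} (hA : IsPrimitiveDiag A)
    {v : ι → ℝ} (hv : ∀ i, 0 ≤ v i) {i₀ i₁ : ι} (h₀ : 0 < v i₀) (h₁ : v i₁ = 0) :
    #{i | 0 < v i} < #{i | 0 < (A *ᵥ v) i} := by
  obtain ⟨hnn, hdiag, m, hm⟩ := hA
  refine card_lt_card (Finset.ssubset_iff_subset_ne.2 ⟨fun i hi => ?_, fun heq => ?_⟩)
  · simp only [mem_filter, mem_univ, true_and] at hi ⊢
    exact mulVec_pos_of_entry_pos hnn hv (hdiag i) hi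
  · have hsupp : ∀ i, 0 < (A *ᵥ v) i → 0 < v i := fun i hi => by
      have : i ∈ ({i | 0 < v i} : Finset ι) := heq ▸ by simpa using hi
      simpa using this
    -- A support that does not grow confines all later iterates, which contradicts the positivity of
    -- `A ^ m`.
    have hpow : ∀ k : ℕ, (∀ i, 0 ≤ ((A ^ k) *ᵥ v) i) ∧
        ∀ i, 0 < ((A ^ k) *ᵥ v) i → 0 < v i := by
      intro k
      induction k with
      | zero => simpa using hv
      | succ k ih =>
        rw [pow_succ', ← mulVec_mulVec]
        refine ⟨mulVec_nonneg_of_nonneg hnn ih.1, fun i hi => ?_⟩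
        obtain ⟨j, -, hj⟩ := exists_lt_of_sum_lt (s := univ) (f := fun _ => (0 : ℝ))
          (by simpa [mulVec, dotProduct] using hi)
        have hA' : 0 < A i j := (hnn i j).lt_of_ne' fun h => by simp [h] at hj
        exact hsupp i (mulVec_pos_of_entry_pos hnn hv hA'
          (ih.2 j (pos_of_mul_pos_right hj hA'.le)))
    have := (hpow m).2 i₁ (mulVec_pos_of_entry_pos (fun i j => (hm i j).le) hv (hm i₁ i₀) h₀)
    exact this.ne' h₁

/-- Each factor adds at least one index to the support of a column, starting from the single index
`c`, until the support is full. -/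
theorem card_support_list_prod (L : List (Matrix ι ι ℝ)) (hL : ∀ A ∈ L, IsPrimitiveDiag A)
    (c : ι) : (∀ i, 0 ≤ (L.prod *ᵥ Pi.single c 1) i) ∧
      min (Fintype.card ι) (L.length + 1) ≤ #{i | 0 < (L.prod *ᵥ Pi.single c 1) i} := by
  induction L with
  | nil =>
    have h : ∀ i, (0 : ℝ) ≤ (Pi.single c 1 : ι → ℝ) i := fun i => by
      rw [Pi.single_apply]; split_ifs <;> norm_num
    refine ⟨by simpa only [List.prod_nil, one_mulVec] using h, (min_le_right _ _).trans ?_⟩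
    simp only [List.length_nil, zero_add, List.prod_nil, one_mulVec]
    exact card_pos.2 ⟨c, by simp⟩
  | cons A L ih =>
    obtain ⟨h1, h2⟩ := ih fun B hB => hL B (List.mem_cons_of_mem _ hB)
    have hA := hL A List.mem_cons_self
    rw [List.prod_cons, ← mulVec_mulVec]
    set v := L.prod *ᵥ Pi.single c 1
    refine ⟨mulVec_nonneg_of_nonneg hA.1 h1, ?_⟩
    by_cases hfull : ∀ i, 0 < v i
    · have : ({i | 0 < (A *ᵥ v) i} : Finset ι) = univ := by
        ext i
        simpa using mulVec_pos_of_entry_pos hA.1 h1 (hA.2.1 i) (hfull i)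
      rw [this]
      exact min_le_left _ _
    · push Not at hfull
      obtain ⟨i₁, hi₁⟩ := hfull
      have hpos : 0 < #{i | 0 < v i} :=
        lt_of_lt_of_le (lt_min (Fintype.card_pos_iff.2 ⟨c⟩) (Nat.succ_pos _)) h2
      obtain ⟨i₀, hi₀⟩ := card_pos.1 hpos
      have := hA.card_support_lt h1 (i₀ := i₀) (by simpa using hi₀) (hi₁.antisymm (h1 i₁))
      simp only [List.length_cons]
      omega

theorem list_prod_pos (L : List (Matrix ι ι ℝ)) (hL : ∀ A ∈ L, IsPrimitiveDiag A)
    (hlen : Fintype.card ι ≤ L.length) (i j : ι) : 0 < L.prod i j := by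
  have h := (card_support_list_prod L hL j).2
  rw [min_eq_left (by omega)] at h
  have h2 := (Finset.card_eq_iff_eq_univ _).1 (le_antisymm (card_le_univ _) h)
  have h3 : i ∈ ({i | 0 < (L.prod *ᵥ Pi.single j 1) i} : Finset ι) := by
    rw [h2]; exact mem_univ i
  simpa using h3

end Primitive

/-- Sufficiently long products of oscillatory matrices are TP. -/
theorem exists_isTP_list_prod (n : ℕ) : ∃ H : ℕ, ∀ L : List (Matrix (Fin n) (Fin n) ℝ),
    (∀ A ∈ L, IsOscillatory A) → H ≤ L.length → IsTP L.prod := by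
  -- The sum dominates the size of every compound, so one length serves all minor orders.
  refine ⟨∑ k ∈ range (n + 1), Fintype.card (Fin k ↪o Fin n), fun L hL hlen k r c => ?_⟩
  have hk : k ≤ n := by simpa using Fintype.card_le_of_embedding r.toEmbedding
  have h1 := list_prod_pos (L.map (compoundHom k n))
    (fun B hB => by
      obtain ⟨A, hA, rfl⟩ := List.mem_map.1 hB
      exact (hL A hA).compound k)
    (by
      rw [List.length_map]
      exact (single_le_sum (f := fun k => Fintype.card (Fin k ↪o Fin n))
        (fun _ _ => Nat.zero_le _) (mem_range.2 (Nat.lt_succ_of_le hk))).trans hlen) r c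
  rw [← map_list_prod] at h1
  exact h1

theorem exists_isODTS (n : ℕ) : ∃ H : ℕ, ∀ p ≥ H, ∀ A : ℕ → Matrix (Fin n) (Fin n) ℝ,
    (∀ k, IsOscillatory (A k)) → IsODTS p A := by
  obtain ⟨H, hH⟩ := exists_isTP_list_prod n
  refine ⟨H, fun p hp A hA => ⟨hA, fun t _ => hH _ (fun B hB => ?_) (by simpa using hp)⟩⟩
  obtain ⟨i, rfl⟩ := (List.mem_ofFn' _ _).1 (List.mem_reverse.1 hB)
  exact hA _

/-! ### Greedy alternation levels and sign variation counts -/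

/-- `Alt p l j`: there are indices `i₀ < ⋯ < i_{l-1}` smaller than `j` with `p q i_q` for all `q`. -/
def Alt {n : ℕ} (p : ℕ → Fin n → Prop) : ℕ → ℕ → Prop
  | 0, _ => True
  | l + 1, j => ∃ i : Fin n, i.val < j ∧ p l i ∧ Alt p l i.val

section Alt

variable {n : ℕ} {p : ℕ → Fin n → Prop}

theorem Alt.mono {l j j' : ℕ} (h : Alt p l j) (hj : j ≤ j') : Alt p l j' := by
  cases l with
  | zero => trivial
  | succ l =>
    obtain ⟨i, hi, h⟩ := h
    exact ⟨i, hi.trans_le hj, h⟩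

theorem Alt.imp {p' : ℕ → Fin n → Prop} (hp : ∀ l i, p l i → p' l i) {l j : ℕ} (h : Alt p l j) :
    Alt p' l j := by
  induction l generalizing j with
  | zero => trivial
  | succ l ih =>
    obtain ⟨i, hi, h1, h2⟩ := h
    exact ⟨i, hi, hp _ _ h1, ih h2⟩

theorem Alt.of_le {l l' j : ℕ} (h : Alt p l j) (hl : l' ≤ l) : Alt p l' j := by
  induction l, hl using Nat.le_induction with
  | base => exact h
  | succ l _ ih =>
    obtain ⟨i, hi, -, h2⟩ := h
    exact ih (h2.mono hi.le)

theorem Alt.le {l j : ℕ} (h : Alt p l j) : l ≤ j := by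
  induction l generalizing j with
  | zero => exact Nat.zero_le _
  | succ l ih =>
    obtain ⟨i, hi, -, h2⟩ := h
    exact (ih h2).trans_lt hi

theorem Alt.exists_strictMono {l j : ℕ} (h : Alt p l j) :
    ∃ r : Fin l → Fin n, StrictMono r ∧ ∀ q, (r q).val < j ∧ p q (r q) := by
  induction l generalizing j with
  | zero => exact ⟨Fin.elim0, fun i => i.elim0, fun i => i.elim0⟩
  | succ l ih =>
    obtain ⟨i, hi, h1, h2⟩ := h
    obtain ⟨r, hr, hr2⟩ := ih h2
    refine ⟨Fin.snoc r i, ?_, ?_⟩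
    · intro a b
      refine Fin.lastCases ?_ (fun b => ?_) b
      · refine Fin.lastCases (fun h => (lt_irrefl _ h).elim) (fun a _ => ?_) a
        simpa using (hr2 a).1
      · refine Fin.lastCases (fun h => ?_) (fun a h => ?_) a
        · exact absurd h (not_lt_of_ge (Fin.le_last _))
        · simpa using hr (Fin.castSucc_lt_castSucc_iff.1 h)
    · intro q
      refine Fin.lastCases ?_ (fun q => ?_) q
      · simpa using ⟨hi, h1⟩
      · simpa using ⟨(hr2 q).1.trans hi, (hr2 q).2⟩

open Classical in
/-- The largest `l` with `Alt p l j`. -/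
noncomputable def altLevel (p : ℕ → Fin n → Prop) (j : ℕ) : ℕ :=
  Nat.findGreatest (fun l => Alt p l j) j

theorem le_altLevel {l j : ℕ} : l ≤ altLevel p j ↔ Alt p l j := by
  classical
  refine ⟨fun h => ?_, fun h => Nat.le_findGreatest h.le h⟩
  have : Alt p (altLevel p j) j :=
    Nat.findGreatest_spec (P := fun l => Alt p l j) (Nat.zero_le j) trivial
  exact this.of_le h

theorem altLevel_mono {j j' : ℕ} (h : j ≤ j') : altLevel p j ≤ altLevel p j' :=
  le_altLevel.2 ((le_altLevel.1 le_rfl).mono h)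

/-- A longest chain up to `i` cannot end at `i` if `i` carries the next sign, so it lies below `i`,
and appending `i` would lengthen it. -/
theorem altLevel_succ_not (hp : ∀ l i, p l i → ¬ p (l + 1) i) (i : Fin n) :
    ¬ p (altLevel p (i + 1)) i := by
  intro h
  have h1 : Alt p (altLevel p (i + 1)) (i + 1) := le_altLevel.1 le_rfl
  have h2 : Alt p (altLevel p (i + 1)) i := by
    revert h h1
    cases altLevel p (i + 1) with
    | zero => exact fun _ _ => trivial
    | succ l =>
      rintro h ⟨i', hi', h1, h2⟩
      rcases (Nat.lt_succ_iff.1 hi').lt_or_eq with h3 | h3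
      · exact ⟨i', h3, h1, h2⟩
      · rw [Fin.ext h3] at h1
        exact absurd h (hp _ _ h1)
  have h3 : Alt p (altLevel p (i + 1) + 1) (i + 1) := ⟨i, Nat.lt_succ_self _, h, h2⟩
  exact Nat.not_succ_le_self _ (le_altLevel.2 h3)

/-- The witness is the place where level `l + 1` is first reached; level `l + 2` there would need `l
+ 1` strictly earlier. It supplies a nonzero entry in each block when levels cut a vector into
blocks of constant sign. -/
theorem exists_altLevel_eq {l j : ℕ} (hl : l + 1 ≤ altLevel p j) :
    ∃ i : Fin n, altLevel p (i + 1) = l + 1 ∧ p l i := by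
  classical
  have hex : ∃ j, Alt p (l + 1) j := ⟨j, le_altLevel.1 hl⟩
  obtain ⟨i, hi, h1, h2⟩ := Nat.find_spec hex
  refine ⟨i, le_antisymm (not_lt.1 fun h => ?_) (le_altLevel.2 ⟨i, Nat.lt_succ_self _, h1, h2⟩), h1⟩
  obtain ⟨i', hi', -, h4⟩ := le_altLevel.1 (Nat.succ_le_of_lt h)
  exact Nat.find_min hex ((Nat.lt_succ_iff.1 hi').trans_lt hi) h4

end Alt

/-- The sign pattern `+ - + ⋯` holds strictly. -/
def StrictSign {n : ℕ} (z : Fin n → ℝ) (l : ℕ) (i : Fin n) : Prop := 0 < (-1) ^ l * z i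

/-- The sign pattern `+ - + ⋯` holds weakly. -/
def WeakSign {n : ℕ} (z : Fin n → ℝ) (l : ℕ) (i : Fin n) : Prop := 0 ≤ (-1) ^ l * z i

/-- The maximal length of a strictly alternating subsequence of `z` starting with `+`. -/
noncomputable def strictVar {n : ℕ} (z : Fin n → ℝ) : ℕ := altLevel (StrictSign z) n

/-- The maximal length of a weakly alternating subsequence of `z` starting with `+`. -/
noncomputable def weakVar {n : ℕ} (z : Fin n → ℝ) : ℕ := altLevel (WeakSign z) n

theorem strictVar_le_weakVar {n : ℕ} (z : Fin n → ℝ) : strictVar z ≤ weakVar z :=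
  le_altLevel.2 ((le_altLevel.1 le_rfl).imp fun _ _ h => le_of_lt h)

theorem StrictSign.not_succ {n : ℕ} {z : Fin n → ℝ} (l : ℕ) (i : Fin n) (h : StrictSign z l i) :
    ¬ StrictSign z (l + 1) i := by
  unfold StrictSign at *
  rw [pow_succ]
  linarith

/-- A weak alternation is obtained by putting the first entry before a strict alternation of
opposite sign. -/
theorem Alt.cons_zero {n : ℕ} {z : Fin (n + 1) → ℝ} (h0 : 0 ≤ z 0) {l j : ℕ}
    (h : Alt (StrictSign (-z)) l j) (hj : 0 < j) : Alt (WeakSign z) (l + 1) j := by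
  induction l generalizing j with
  | zero => exact ⟨0, hj, by simpa [WeakSign] using h0, trivial⟩
  | succ l ih =>
    obtain ⟨i, hi, h1, h2⟩ := h
    refine ⟨i, hi, ?_, ih h2 (Nat.pos_of_ne_zero fun hi0 => ?_)⟩
    · simp only [StrictSign, WeakSign, Pi.neg_apply, pow_succ] at *
      linarith
    · cases l with
      | zero =>
        have : i = 0 := Fin.ext hi0
        subst this
        simp only [StrictSign, Pi.neg_apply, pow_zero] at h1
        linarith
      | succ l =>
        obtain ⟨i', hi', -⟩ := h2
        omega

theorem strictVar_neg_lt_weakVar {n : ℕ} {z : Fin (n + 1) → ℝ} (h0 : 0 ≤ z 0) :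
    strictVar (-z) < weakVar z :=
  le_altLevel.2 (Alt.cons_zero h0 (le_altLevel.1 le_rfl) (Nat.succ_pos n))

/-! ### Variation diminishing property -/

section VariationDiminishing

variable {m n k : ℕ}

/-- Minors of `A * B` for a TP matrix `A` and a nonnegative matrix `B` whose columns are supported
on successive blocks of indices. -/
theorem IsTP.det_mul_block_nonneg {A : Matrix (Fin m) (Fin n) ℝ} (hA : IsTP A)
    {r : Fin k → Fin m} (hr : StrictMono r) {B : Matrix (Fin n) (Fin k) ℝ}
    (hB : ∀ j l, 0 ≤ B j l) (hblock : ∀ j j' l l', l < l' → B j l ≠ 0 → B j' l' ≠ 0 → j < j') :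
    0 ≤ (A.submatrix r id * B).det ∧
      ((∀ l, ∃ j, B j l ≠ 0) → 0 < (A.submatrix r id * B).det) := by
  rw [det_mul_eq_sum]
  have hterm : ∀ p : Fin k → Fin n, (∀ l, B (p l) l ≠ 0) →
      0 < (∏ l, B (p l) l) * ((A.submatrix r id).submatrix id p).det := fun p hp =>
    mul_pos (prod_pos fun l _ => (hB _ _).lt_of_ne' (hp l))
      (hA k (OrderEmbedding.ofStrictMono r hr)
        (OrderEmbedding.ofStrictMono p fun l l' h => hblock _ _ l l' h (hp l) (hp l')))
  have hnn : ∀ p ∈ (univ : Finset (Fin k → Fin n)),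
      0 ≤ (∏ l, B (p l) l) * ((A.submatrix r id).submatrix id p).det := fun p _ => by
    by_cases hp : ∀ l, B (p l) l ≠ 0
    · exact (hterm p hp).le
    · push Not at hp
      obtain ⟨l, hl⟩ := hp
      rw [prod_eq_zero (f := fun l => B (p l) l) (mem_univ l) hl, zero_mul]
  refine ⟨sum_nonneg hnn, fun h => ?_⟩
  choose p hp using h
  exact sum_pos' hnn ⟨p, mem_univ _, hterm p hp⟩

/-- **Variation diminishing property** of TP matrices, with control of the leading sign. -/
theorem IsTP.weakVar_mulVec_le {A : Matrix (Fin m) (Fin n) ℝ} (hA : IsTP A)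
    {x : Fin n → ℝ} (hx : x ≠ 0) : weakVar (A *ᵥ x) ≤ strictVar x := by
  by_contra! hlt
  set L := strictVar x with hL
  -- The level just after `j` numbers the block of `j`. Entries in block `l` have weak sign `-(-1) ^
  -- l`, whence the vector `c` below. Block 0 may contain only zeros or be empty; blocks `1, …, L`
  -- contain nonzero entries.
  set b : Fin n → ℕ := fun j => altLevel (StrictSign x) (j + 1) with hb
  have hbL : ∀ j, b j < L + 1 := fun j => Nat.lt_succ_of_le (altLevel_mono j.2)
  have hbmono : ∀ j j', b j < b j' → j < j' := fun j j' h => by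
    by_contra! hle
    exact h.not_ge (altLevel_mono (Nat.succ_le_succ hle))
  obtain ⟨r, hr, hy⟩ := (le_altLevel.1 (Nat.succ_le_of_lt hlt)).exists_strictMono
  replace hy : ∀ i : Fin (L + 1), 0 ≤ (-1) ^ (i : ℕ) * (A *ᵥ x) (r i) := fun i => (hy i).2
  set B : Matrix (Fin n) (Fin (L + 1)) ℝ := Matrix.of fun j l => if b j = l then |x j| else 0
    with hBdef
  have hBne : ∀ {j l}, B j l ≠ 0 ↔ b j = l ∧ x j ≠ 0 := fun {j l} => by
    simp [hBdef]
  have hBnn : ∀ j l, 0 ≤ B j l := fun j l => by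
    simp only [hBdef, of_apply]
    split_ifs
    · exact abs_nonneg _
    · exact le_rfl
  have hblock : ∀ j j' l l', l < l' → B j l ≠ 0 → B j' l' ≠ 0 → j < j' := fun j j' l l' h h1 h2 =>
    hbmono j j' (by rw [(hBne.1 h1).1, (hBne.1 h2).1]; exact h)
  set c : Fin (L + 1) → ℝ := fun l => -(-1) ^ (l : ℕ) with hc
  have hBc : B *ᵥ c = x := by
    funext j
    have h1 : ¬ 0 < (-1) ^ (b j) * x j := altLevel_succ_not (fun l i => StrictSign.not_succ l i) j
    simp only [mulVec, dotProduct]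
    rw [sum_eq_single ⟨b j, hbL j⟩]
    · simp only [hBdef, of_apply, if_true, hc]
      rcases neg_one_pow_eq_or ℝ (b j) with h | h <;> rw [h] at h1 ⊢
      · rw [abs_of_nonpos (by linarith)]; ring
      · rw [abs_of_nonneg (by linarith)]; ring
    · intro l _ hl
      have : b j ≠ l := fun h => hl (Fin.ext h.symm)
      simp [hBdef, this]
    · simp
  set V := A.submatrix r id * B with hV
  have hVc : V *ᵥ c = fun i => (A *ᵥ x) (r i) := by
    rw [hV, ← mulVec_mulVec, hBc]
    rfl
  have hdetV := hA.det_mul_block_nonneg hr hBnn hblock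
  have hD : ∀ i : Fin (L + 1), 0 < (V.submatrix i.succAbove Fin.succ).det := fun i => by
    have h1 : V.submatrix i.succAbove Fin.succ =
        A.submatrix (r ∘ i.succAbove) id * B.submatrix id Fin.succ := by
      ext a b
      simp [hV, mul_apply]
    rw [h1]
    refine (hA.det_mul_block_nonneg (hr.comp (Fin.strictMono_succAbove i))
      (fun j l => hBnn j l.succ) (fun j j' l l' h => hblock j j' _ _ (Fin.succ_lt_succ_iff.2 h))).2
      fun l => ?_
    obtain ⟨j, hj, hs⟩ := exists_altLevel_eq (p := StrictSign x) (j := n) (l := l)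
      (Nat.succ_le_of_lt l.2)
    exact ⟨j, hBne.2 ⟨by simpa using hj, fun h => by simp [StrictSign, h] at hs⟩⟩
  -- Cramer's rule: replace column 0 of `V` by `V *ᵥ c` and expand along it. As `c 0 = -1`, the
  -- nonnegative terms on the left sum to `-det V ≤ 0`, so all of them vanish.
  have hexp : ∑ i : Fin (L + 1), (-1) ^ (i : ℕ) * (A *ᵥ x) (r i) *
      (V.submatrix i.succAbove Fin.succ).det = - V.det := by
    have h1 : (V.updateCol 0 (V *ᵥ c)).det = V.det * c 0 := by
      rw [← cramer_apply, cramer_eq_adjugate_mulVec, mulVec_mulVec, adjugate_mul, smul_mulVec,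
        one_mulVec]
      rfl
    rw [det_succ_column_zero] at h1
    simp only [updateCol_self, hVc] at h1
    rw [show -V.det = V.det * c 0 by simp [hc], ← h1]
    refine sum_congr rfl fun i _ => ?_
    congr 2
  have hnn : ∀ i ∈ (univ : Finset (Fin (L + 1))), 0 ≤ (-1) ^ (i : ℕ) * (A *ᵥ x) (r i) *
      (V.submatrix i.succAbove Fin.succ).det := fun i _ => mul_nonneg (hy i) (hD i).le
  have hsum0 : ∑ i : Fin (L + 1), (-1) ^ (i : ℕ) * (A *ᵥ x) (r i) *
      (V.submatrix i.succAbove Fin.succ).det = 0 :=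
    le_antisymm (by rw [hexp]; linarith [hdetV.1]) (sum_nonneg hnn)
  have hy0 : ∀ i, (A *ᵥ x) (r i) = 0 := fun i => by
    have := (sum_eq_zero_iff_of_nonneg hnn).1 hsum0 i (mem_univ i)
    simpa [(hD i).ne'] using this
  -- A nonzero block 0 would make every block nonzero and `det V` positive.
  have hB0 : ∀ j, B j 0 = 0 := by
    by_contra! h
    refine (hdetV.2 fun l => ?_).ne' (by linarith)
    refine Fin.cases h (fun l => ?_) l
    obtain ⟨j, hj, hs⟩ := exists_altLevel_eq (p := StrictSign x) (j := n) (l := l)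
      (Nat.succ_le_of_lt l.2)
    exact ⟨j, hBne.2 ⟨by simpa using hj, fun h => by simp [StrictSign, h] at hs⟩⟩
  have hV0 : ∀ i, V i 0 = 0 := fun i => by simp [hV, mul_apply, hB0]
  -- Without block 0, the other columns form a nonsingular homogeneous system on `L` of the rows.
  have hcs : (fun l : Fin L => c l.succ) = 0 := by
    refine eq_zero_of_mulVec_eq_zero (hD 0).ne' ?_
    funext i
    have := congrFun hVc ((0 : Fin (L + 1)).succAbove i)
    rw [hy0] at this
    simpa [mulVec, dotProduct, Fin.sum_univ_succ, hV0] using this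
  refine hx ?_
  rw [← hBc]
  funext j
  simp only [mulVec, dotProduct, Fin.sum_univ_succ, hB0, zero_mul, zero_add, Pi.zero_apply]
  exact sum_eq_zero fun l _ => by rw [show c l.succ = 0 from congrFun hcs l, mul_zero]

end VariationDiminishing

/-! ### Convergence of orbits of variation diminishing maps -/

theorem exists_forall_ge_eq_of_antitone {g : ℕ → ℕ} (hg : Antitone g) :
    ∃ K, ∀ k ≥ K, g k = g K :=
  ⟨Function.argmin g, fun _ hk => le_antisymm (hg hk) (Function.argmin_le g _)⟩

/-- Along a trajectory on which the variation is diminished, the sign of the first entry is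
eventually constant and nonzero. -/
theorem eventually_sign_const {n : ℕ} {u : ℕ → (Fin (n + 1) → ℝ)}
    (h₁ : ∀ k, weakVar (u (k + 1)) ≤ strictVar (u k))
    (h₂ : ∀ k, weakVar (-u (k + 1)) ≤ strictVar (-u k)) :
    ∃ K, (∀ k ≥ K, 0 < u k 0) ∨ (∀ k ≥ K, u k 0 < 0) := by
  obtain ⟨K₁, hK₁⟩ := exists_forall_ge_eq_of_antitone (g := fun k => weakVar (u k))
    (antitone_nat_of_succ_le fun k => (h₁ k).trans (strictVar_le_weakVar _))
  obtain ⟨K₂, hK₂⟩ := exists_forall_ge_eq_of_antitone (g := fun k => weakVar (-u k))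
    (antitone_nat_of_succ_le fun k => (h₂ k).trans (strictVar_le_weakVar _))
  have hs₁ : ∀ k ≥ K₁, weakVar (u K₁) ≤ strictVar (u k) := fun k hk =>
    (hK₁ (k + 1) (by omega)).ge.trans (h₁ k)
  have hs₂ : ∀ k ≥ K₂, weakVar (-u K₂) ≤ strictVar (-u k) := fun k hk =>
    (hK₂ (k + 1) (by omega)).ge.trans (h₂ k)
  -- A nonnegative first entry orders the two limiting counts strictly one way, a nonpositive one
  -- the other way; so both cannot occur late, and neither can zero.
  have hpos : ∀ k, K₁ ⊔ K₂ ≤ k → 0 ≤ u k 0 → weakVar (-u K₂) < weakVar (u K₁) := fun k hk h => by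
    have := strictVar_neg_lt_weakVar h
    exact (hs₂ k (le_of_max_le_right hk)).trans_lt
      (this.trans_eq (hK₁ k (le_of_max_le_left hk)))
  have hneg : ∀ k, K₁ ⊔ K₂ ≤ k → u k 0 ≤ 0 → weakVar (u K₁) < weakVar (-u K₂) := fun k hk h => by
    have := strictVar_neg_lt_weakVar (z := -u k) (by simpa using h)
    rw [neg_neg] at this
    exact (hs₁ k (le_of_max_le_left hk)).trans_lt
      (this.trans_eq (hK₂ k (le_of_max_le_right hk)))
  refine ⟨K₁ ⊔ K₂, ?_⟩
  rcases le_or_gt 0 (u (K₁ ⊔ K₂) 0) with h | h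
  · exact Or.inl fun k hk => not_le.1 fun h' => lt_asymm (hpos _ le_rfl h) (hneg k hk h')
  · exact Or.inr fun k hk => not_le.1 fun h' => lt_asymm (hneg _ le_rfl h.le) (hpos k hk h')

/-- A map under which differences of distinct points of `Ω` stay nonzero and have their variation
diminished. -/
def VariationDiminishingOn {n : ℕ} (P : (Fin n → ℝ) → (Fin n → ℝ)) (Ω : Set (Fin n → ℝ)) : Prop :=
  ∀ a ∈ Ω, ∀ b ∈ Ω, a ≠ b → P a ≠ P b ∧ weakVar (P a - P b) ≤ strictVar (a - b)

section Dynamics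

variable {n : ℕ} {Ω : Set (Fin (n + 1) → ℝ)} {P : (Fin (n + 1) → ℝ) → (Fin (n + 1) → ℝ)}

theorem VariationDiminishingOn.eventually_sign_const (hP : VariationDiminishingOn P Ω)
    (hmaps : Set.MapsTo P Ω Ω) {a b : Fin (n + 1) → ℝ} (ha : a ∈ Ω) (hb : b ∈ Ω) (hab : a ≠ b) :
    ∃ K, (∀ k ≥ K, 0 < (P^[k] a - P^[k] b) 0) ∨ (∀ k ≥ K, (P^[k] a - P^[k] b) 0 < 0) := by
  have hmem : ∀ {a}, a ∈ Ω → ∀ k, P^[k] a ∈ Ω := fun ha k => hmaps.iterate k ha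
  have hne : ∀ k, P^[k] a ≠ P^[k] b := fun k => by
    induction k with
    | zero => exact hab
    | succ k ih =>
      rw [Function.iterate_succ_apply', Function.iterate_succ_apply']
      exact (hP _ (hmem ha k) _ (hmem hb k) ih).1
  refine OscSys.eventually_sign_const (u := fun k => P^[k] a - P^[k] b) (fun k => ?_) fun k => ?_
  · simp only [Function.iterate_succ_apply']
    exact (hP _ (hmem ha k) _ (hmem hb k) (hne k)).2
  · simp only [Function.iterate_succ_apply', neg_sub]
    exact (hP _ (hmem hb k) _ (hmem ha k) (hne k).symm).2

theorem VariationDiminishingOn.exists_tendsto_apply_zero (hP : VariationDiminishingOn P Ω)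
    (hmaps : Set.MapsTo P Ω Ω) (hΩ : IsCompact Ω) {x : Fin (n + 1) → ℝ} (hx : x ∈ Ω) :
    ∃ c, Tendsto (fun k => P^[k] x 0) atTop (𝓝 c) := by
  have hmem : ∀ k, P^[k] x ∈ Ω := fun k => hmaps.iterate k hx
  by_cases hfix : P x = x
  · refine ⟨x 0, ?_⟩
    simp only [Function.iterate_fixed hfix]
    exact tendsto_const_nhds
  obtain ⟨K, hK⟩ := hP.eventually_sign_const hmaps (hmaps hx) hx hfix
  simp only [← Function.iterate_succ_apply, Pi.sub_apply, sub_pos, sub_neg] at hK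
  have hbdd : Bornology.IsBounded ((fun y : Fin (n + 1) → ℝ => y 0) '' Ω) :=
    (hΩ.image (continuous_apply 0)).isBounded
  have hsub : Set.range (fun k => P^[k + K] x 0) ⊆ (fun y : Fin (n + 1) → ℝ => y 0) '' Ω := by
    rintro _ ⟨k, rfl⟩
    exact ⟨_, hmem _, rfl⟩
  rcases hK with hK | hK
  · refine ⟨⨆ k, P^[k + K] x 0, (tendsto_add_atTop_iff_nat K).1
      (tendsto_atTop_ciSup (monotone_nat_of_le_succ fun k => ?_) (hbdd.bddAbove.mono hsub))⟩
    rw [add_right_comm]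
    exact (hK (k + K) (by omega)).le
  · refine ⟨⨅ k, P^[k + K] x 0, (tendsto_add_atTop_iff_nat K).1
      (tendsto_atTop_ciInf (antitone_nat_of_succ_le fun k => ?_) (hbdd.bddBelow.mono hsub))⟩
    rw [add_right_comm]
    exact (hK (k + K) (by omega)).le

theorem VariationDiminishingOn.exists_tendsto_fixed (hP : VariationDiminishingOn P Ω)
    (hmaps : Set.MapsTo P Ω Ω) (hcont : ContinuousOn P Ω) (hΩ : IsCompact Ω)
    {x : Fin (n + 1) → ℝ} (hx : x ∈ Ω) :
    ∃ q ∈ Ω, P q = q ∧ Tendsto (fun k => P^[k] x) atTop (𝓝 q) := by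
  have hmem : ∀ k, P^[k] x ∈ Ω := fun k => hmaps.iterate k hx
  obtain ⟨c, hc⟩ := hP.exists_tendsto_apply_zero hmaps hΩ hx
  -- By continuity, `P^[j] q` is a limit of later orbit points, whose first coordinates tend to `c`.
  have hcoord : ∀ q ∈ Ω, MapClusterPt q atTop (fun k => P^[k] x) → ∀ j, P^[j] q 0 = c := by
    intro q hq hcl j
    obtain ⟨ψ, hψ, hlim⟩ := hcl.tendsto_subseq
    have h1 : Tendsto (fun k => P^[j] (P^[ψ k] x)) atTop (𝓝 (P^[j] q)) :=
      ((hcont.iterate hmaps j) q hq).tendsto.comp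
        (tendsto_nhdsWithin_iff.2 ⟨hlim, Eventually.of_forall fun k => hmem _⟩)
    have h2 : Tendsto (fun k => P^[j + ψ k] x 0) atTop (𝓝 c) :=
      hc.comp (tendsto_atTop_mono (fun k => Nat.le_add_left _ _) hψ.tendsto_atTop)
    refine tendsto_nhds_unique ((tendsto_pi_nhds.1 h1) 0) ?_
    simpa only [Function.iterate_add_apply] using h2
  have hcoincide : ∀ a ∈ Ω, ∀ b ∈ Ω, (∀ j, P^[j] a 0 = c) → (∀ j, P^[j] b 0 = c) → a = b := by
    intro a ha b hb hac hbc
    by_contra hab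
    obtain ⟨K, hK | hK⟩ := hP.eventually_sign_const hmaps ha hb hab
    all_goals
      have := hK K le_rfl
      simp [hac, hbc] at this
  obtain ⟨q, hq, hcl⟩ := hΩ.exists_mapClusterPt (f := atTop) (u := fun k => P^[k] x)
    (tendsto_principal.2 (Eventually.of_forall hmem))
  have hqc := hcoord q hq hcl
  refine ⟨q, hq, hcoincide _ (hmaps hq) _ hq (fun j => ?_) hqc,
    hΩ.tendsto_nhds_of_unique_mapClusterPt (Eventually.of_forall hmem) fun y hy hycl =>
      hcoincide y hy q hq (hcoord y hy hycl) hqc⟩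
  rw [← Function.iterate_succ_apply]
  exact hqc (j + 1)

end Dynamics

/-! ### Variational system and solution flow -/

/-- The fundamental theorem of calculus along a segment: the line integral of the Jacobian maps
the difference of two points to the difference of their images. -/
theorem lineIntegral_mulVec_sub {n : ℕ} {f : ℕ → (Fin n → ℝ) → (Fin n → ℝ)} {k : ℕ}
    (hf : ContDiff ℝ 1 (f k)) (a b : Fin n → ℝ) :
    lineIntegral f k a b *ᵥ (a - b) = f k a - f k b := by
  set γ : ℝ → (Fin n → ℝ) := fun r => r • a + (1 - r) • b with hγ
  have hγc : Continuous γ := by fun_prop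
  have hγd : ∀ r, HasDerivAt γ (a - b) r := fun r => by
    have : HasDerivAt γ ((1 : ℝ) • a + (0 - 1 : ℝ) • b) r := ((hasDerivAt_id r).smul_const a).add
      (((hasDerivAt_const r (1 : ℝ)).sub (hasDerivAt_id r)).smul_const b)
    simpa [sub_eq_add_neg] using this
  have hJ : ∀ r i, ∑ j, jacobian f k (γ r) i j * (a - b) j = (fderiv ℝ (f k) (γ r) (a - b)) i :=
    fun r i => congrFun (LinearMap.toMatrix'_mulVec
      (fderiv ℝ (f k) (γ r) : (Fin n → ℝ) →ₗ[ℝ] (Fin n → ℝ)) (a - b)) i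
  have hJc : ∀ i j, Continuous fun r => jacobian f k (γ r) i j := fun i j => by
    simp only [jacobian, LinearMap.toMatrix'_apply]
    have h1 : Continuous fun r => fderiv ℝ (f k) (γ r) :=
      (hf.continuous_fderiv one_ne_zero).comp hγc
    exact (continuous_apply i).comp (h1.clm_apply continuous_const)
  funext i
  have hd : ∀ r, HasDerivAt (fun r => f k (γ r) i) ((fderiv ℝ (f k) (γ r) (a - b)) i) r :=
    fun r => (hasDerivAt_pi.1
      ((hf.differentiable one_ne_zero (γ r)).hasFDerivAt.comp_hasDerivAt r (hγd r))) i
  have hint : ∫ r in (0 : ℝ)..1, (fderiv ℝ (f k) (γ r) (a - b)) i = f k (γ 1) i - f k (γ 0) i := by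
    refine intervalIntegral.integral_eq_sub_of_hasDerivAt (fun r _ => hd r)
      (Continuous.intervalIntegrable ?_ _ _)
    simp only [← hJ]
    exact continuous_finsetSum _ fun j _ => (hJc i j).mul continuous_const
  have hγ1 : γ 1 = a := by simp [hγ]
  have hγ0 : γ 0 = b := by simp [hγ]
  rw [hγ1, hγ0] at hint
  rw [Pi.sub_apply, ← hint]
  simp only [← hJ]
  rw [intervalIntegral.integral_finsetSum (f := fun j r => jacobian f k (γ r) i j * (a - b) j)
    fun j _ => ((hJc i j).mul continuous_const).intervalIntegrable _ _]
  simp only [intervalIntegral.integral_mul_const, mulVec, dotProduct, lineIntegral, of_apply, hγ]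

theorem tendsto_of_forall_residue {X : Type*} {u : ℕ → X} {l : Filter X} {p : ℕ} (hp : 0 < p)
    (h : ∀ i < p, Tendsto (fun j => u (j * p + i)) atTop l) : Tendsto u atTop l := by
  intro s hs
  have h1 : ∀ᶠ j in atTop, ∀ i ∈ range p, u (j * p + i) ∈ s :=
    (eventually_all_finset _).2 fun i hi => h i (mem_range.1 hi) hs
  rw [Filter.mem_map]
  filter_upwards [(Nat.tendsto_div_const_atTop hp.ne').eventually h1] with k hk
  have := hk (k % p) (mem_range.2 (Nat.mod_lt k hp))
  rwa [mul_comm, Nat.div_add_mod] at this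

/-- The solution of the difference equation with a given initial value. -/
def flow {n : ℕ} (f : ℕ → (Fin n → ℝ) → (Fin n → ℝ)) : ℕ → (Fin n → ℝ) → (Fin n → ℝ)
  | 0, a => a
  | k + 1, a => f k (flow f k a)

section Flow

variable {n : ℕ} {f : ℕ → (Fin n → ℝ) → (Fin n → ℝ)} {Ω : Set (Fin n → ℝ)}

theorem isSolution_flow (a : Fin n → ℝ) : IsSolution f fun k => flow f k a := fun _ => rfl

theorem IsSolution.eq_flow {x : ℕ → (Fin n → ℝ)} (hx : IsSolution f x) (k : ℕ) :
    x k = flow f k (x 0) := by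
  induction k with
  | zero => rfl
  | succ k ih => rw [hx k, ih]; rfl

theorem continuous_flow (hf : ∀ k, Continuous (f k)) (k : ℕ) : Continuous (flow f k) := by
  induction k with
  | zero => exact continuous_id
  | succ k ih => exact (hf k).comp ih

theorem flow_mem (hΩ : ∀ x, IsSolution f x → x 0 ∈ Ω → ∀ k, x k ∈ Ω) {a : Fin n → ℝ}
    (ha : a ∈ Ω) (k : ℕ) : flow f k a ∈ Ω :=
  hΩ _ (isSolution_flow a) ha k

theorem flow_add_period (hΩ : ∀ x, IsSolution f x → x 0 ∈ Ω → ∀ k, x k ∈ Ω) {p : ℕ}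
    (hper : ∀ k, ∀ a ∈ Ω, f k a = f (k + p) a) {a : Fin n → ℝ} (ha : a ∈ Ω) (k : ℕ) :
    flow f (k + p) a = flow f k (flow f p a) := by
  induction k with
  | zero => rw [zero_add]; rfl
  | succ k ih =>
    rw [Nat.succ_add]
    change f (k + p) (flow f (k + p) a) = f k _
    rw [← hper k _ (flow_mem hΩ ha _), ih]

theorem flow_mul_period_add (hΩ : ∀ x, IsSolution f x → x 0 ∈ Ω → ∀ k, x k ∈ Ω) {p : ℕ}
    (hper : ∀ k, ∀ a ∈ Ω, f k a = f (k + p) a) {a : Fin n → ℝ} (ha : a ∈ Ω) (j k : ℕ) :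
    flow f (j * p + k) a = flow f k ((flow f p)^[j] a) := by
  induction j generalizing a with
  | zero => simp
  | succ j ih =>
    rw [Function.iterate_succ_apply, ← ih (flow_mem hΩ ha p), ← flow_add_period hΩ hper ha]
    congr 1
    ring

theorem eq_add_mul_period {T : ℕ} (hper : ∀ k, ∀ a ∈ Ω, f k a = f (k + T) a) (h k : ℕ)
    (a : Fin n → ℝ) (ha : a ∈ Ω) : f k a = f (k + h * T) a := by
  induction h with
  | zero => simp
  | succ h ih => rw [ih, hper _ a ha]; congr 1; ring

end Flow

theorem reverse_ofFn_prod_mulVec {n : ℕ} {A : ℕ → Matrix (Fin n) (Fin n) ℝ}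
    {z : ℕ → (Fin n → ℝ)} (hz : ∀ k, z (k + 1) = A k *ᵥ z k) (s h : ℕ) :
    (List.ofFn fun i : Fin h => A (s + i)).reverse.prod *ᵥ z s = z (s + h) := by
  induction h with
  | zero => simp
  | succ h ih =>
    rw [List.ofFn_succ', List.concat_eq_append, List.reverse_append, List.reverse_singleton,
      List.singleton_append, List.prod_cons, ← mulVec_mulVec]
    simp only [Fin.val_castSucc, Fin.val_last]
    rw [ih, ← hz, add_assoc]

/-- Over a positive multiple of the order, an ODTS diminishes variation and preserves
nontriviality. -/
theorem IsODTS.weakVar_le {n h : ℕ} {A : ℕ → Matrix (Fin n) (Fin n) ℝ} (hA : IsODTS h A)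
    {z : ℕ → (Fin n → ℝ)} (hz : ∀ k, z (k + 1) = A k *ᵥ z k) (h0 : z 0 ≠ 0) (j : ℕ) :
    z ((j + 1) * h) ≠ 0 ∧ weakVar (z ((j + 1) * h)) ≤ strictVar (z 0) := by
  have hblock : ∀ s, z s ≠ 0 → z (s + h) ≠ 0 ∧ weakVar (z (s + h)) ≤ strictVar (z s) := by
    intro s hs
    have hTP := hA.2 (fun i => s + i) fun i i' hi => Nat.add_lt_add_left hi s
    rw [← reverse_ofFn_prod_mulVec hz s h]
    exact ⟨fun h' => hs (eq_zero_of_mulVec_eq_zero hTP.det_pos.ne' h'), hTP.weakVar_mulVec_le hs⟩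
  induction j with
  | zero => simpa using hblock 0 h0
  | succ j ih =>
    rw [Nat.succ_mul]
    have h1 := hblock _ ih.1
    exact ⟨h1.1, h1.2.trans ((strictVar_le_weakVar _).trans ih.2)⟩

theorem VariationalSystemIsODTS.variationDiminishingOn {n : ℕ}
    {f : ℕ → (Fin n → ℝ) → (Fin n → ℝ)} {Ω : Set (Fin n → ℝ)} {h T : ℕ}
    (hV : VariationalSystemIsODTS f Ω h) (hf : ∀ k, ContDiff ℝ 1 (f k)) (hT : 1 ≤ T) :
    VariationDiminishingOn (flow f (h * T)) Ω := by
  intro a ha b hb hab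
  -- The `h * T` steps split into `T = j + 1` consecutive blocks of length `h`.
  obtain ⟨j, rfl⟩ := Nat.exists_eq_add_of_le' hT
  have := (hV _ _ (isSolution_flow a) (isSolution_flow b) ha hb).weakVar_le
    (z := fun k => flow f k a - flow f k b)
    (fun k => (lineIntegral_mulVec_sub (hf k) _ _).symm) (sub_ne_zero.2 hab) j
  rw [mul_comm h]
  exact ⟨sub_ne_zero.1 this.1, this.2⟩

theorem VariationDiminishingOn.solutionsConvergeToPeriodic {n : ℕ}
    {f : ℕ → (Fin n → ℝ) → (Fin n → ℝ)} {Ω : Set (Fin n → ℝ)} {p : ℕ}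
    (hP : VariationDiminishingOn (flow f p) Ω) (hf : ∀ k, Continuous (f k))
    (hcompact : IsCompact Ω) (hΩ : ∀ x, IsSolution f x → x 0 ∈ Ω → ∀ k, x k ∈ Ω) (hp : 0 < p)
    (hper : ∀ k, ∀ a ∈ Ω, f k a = f (k + p) a) : SolutionsConvergeToPeriodic f Ω p := by
  intro x hx hx0
  obtain ⟨q, hq, hfix, hlim⟩ :
      ∃ q ∈ Ω, flow f p q = q ∧ Tendsto (fun k => (flow f p)^[k] (x 0)) atTop (𝓝 q) := by
    -- In dimension 0 there is no first coordinate to follow, but the space is a single point.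
    cases n with
    | zero =>
      exact ⟨x 0, hx0, Subsingleton.elim _ _,
        tendsto_const_nhds.congr fun _ => Subsingleton.elim _ _⟩
    | succ n =>
      exact hP.exists_tendsto_fixed (fun a ha => flow_mem hΩ ha p)
        (continuous_flow hf p).continuousOn hcompact hx0
  refine ⟨fun k => flow f k q, isSolution_flow q, flow_mem hΩ hq, fun k => ?_,
    tendsto_of_forall_residue hp fun i _ => ?_⟩
  · change flow f (k + p) q = flow f k q
    rw [flow_add_period hΩ hper hq, hfix]
  · have h1 : ∀ j, x (j * p + i) - flow f (j * p + i) q =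
        flow f i ((flow f p)^[j] (x 0)) - flow f i q := fun j => by
      rw [hx.eq_flow (j * p + i), flow_mul_period_add hΩ hper hx0,
        flow_mul_period_add hΩ hper hq, Function.iterate_fixed hfix]
    simp only [h1]
    have := (((continuous_flow hf i).tendsto q).comp hlim).sub_const (flow f i q)
    simpa using this

/-! ### Lowering the period to `T`, and conclusion -/

/-- Along the common period `u * v` the difference is constant, and it tends to zero. -/
theorem eq_of_periodic_of_tendsto_sub {n u v : ℕ} {y y' : ℕ → (Fin n → ℝ)}
    (hy : Function.Periodic y u) (hy' : Function.Periodic y' v) (hu : 0 < u) (hv : 0 < v)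
    (h : Tendsto (fun k => y k - y' k) atTop (𝓝 0)) : y = y' := by
  funext k
  have h1 : Tendsto (fun j : ℕ => k + j * (u * v)) atTop atTop :=
    tendsto_atTop_mono (fun j => (Nat.le_mul_of_pos_right j (Nat.mul_pos hu hv)).trans
      (Nat.le_add_left _ _)) tendsto_id
  have h2 := h.comp h1
  have h3 : ∀ j : ℕ, y (k + j * (u * v)) - y' (k + j * (u * v)) = y k - y' k := fun j => by
    have e1 : y (k + j * (u * v)) = y k := by
      have := hy.nat_mul (j * v) k
      simp only [Nat.cast_id] at this
      rw [← this]; congr 1; ring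
    have e2 : y' (k + j * (u * v)) = y' k := by
      have := hy'.nat_mul (j * u) k
      simp only [Nat.cast_id] at this
      rw [← this]; congr 1; ring
    rw [e1, e2]
  simp only [Function.comp_def, h3] at h2
  exact sub_eq_zero.1 (tendsto_nhds_unique tendsto_const_nhds h2)

/-- Convergence to solutions of periods `H * T` and `(H + 1) * T` gives period `T`. -/
theorem SolutionsConvergeToPeriodic.of_consecutive {n : ℕ}
    {f : ℕ → (Fin n → ℝ) → (Fin n → ℝ)} {Ω : Set (Fin n → ℝ)} {H T : ℕ} (hH : 0 < H) (hT : 0 < T)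
    (h₁ : SolutionsConvergeToPeriodic f Ω (H * T))
    (h₂ : SolutionsConvergeToPeriodic f Ω ((H + 1) * T)) :
    SolutionsConvergeToPeriodic f Ω T := by
  intro x hx hx0
  obtain ⟨y, hy, hyΩ, hyper, hlim⟩ := h₁ x hx hx0
  obtain ⟨y', -, -, hyper', hlim'⟩ := h₂ x hx hx0
  have heq : y' = y :=
    eq_of_periodic_of_tendsto_sub hyper' hyper (Nat.mul_pos (Nat.succ_pos H) hT)
      (Nat.mul_pos hH hT) (by simpa using hlim.sub hlim')
  subst heq
  refine ⟨y', hy, hyΩ, fun k => ?_, hlim⟩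
  rw [← hyper (k + T), ← hyper' k]
  congr 1
  ring

end OscSys

theorem mainTheorem1 (n : ℕ) (f : ℕ → (Fin n → ℝ) → (Fin n → ℝ)) (Ω : Set (Fin n → ℝ)) (T : ℕ)
    (hf : ∀ k, ContDiff ℝ 1 (f k))
    (hcompact : IsCompact Ω) (hconvex : Convex ℝ Ω)
    (hΩ : ∀ x, OscSys.IsSolution f x → x 0 ∈ Ω → ∀ k, x k ∈ Ω)
    (hT : 1 ≤ T) (hper : ∀ k, ∀ a ∈ Ω, f k a = f (k + T) a) :
    (∀ h : ℕ, 1 ≤ h → OscSys.VariationalSystemIsODTS f Ω h →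
      OscSys.SolutionsConvergeToPeriodic f Ω (h * T)) ∧
    (2 ≤ n → (∀ k, ∀ a ∈ Ω, ∀ b ∈ Ω, OscSys.IsOscillatory (OscSys.lineIntegral f k a b)) →
      OscSys.SolutionsConvergeToPeriodic f Ω ((n - 1) * T)) := by
  have part1 : ∀ h : ℕ, 1 ≤ h → OscSys.VariationalSystemIsODTS f Ω h →
      OscSys.SolutionsConvergeToPeriodic f Ω (h * T) := fun h hh hV =>
    (hV.variationDiminishingOn hf hT).solutionsConvergeToPeriodic (fun k => (hf k).continuous)
      hcompact hΩ (Nat.mul_pos hh hT) (OscSys.eq_add_mul_period hper h)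
  refine ⟨part1, fun _ hosc => ?_⟩
  obtain ⟨H, hH⟩ := OscSys.exists_isODTS n
  have hV : ∀ p ≥ H, OscSys.VariationalSystemIsODTS f Ω p := fun p hp x y hx hy hx0 hy0 =>
    hH p hp _ fun k => hosc k _ (hΩ x hx hx0 k) _ (hΩ y hy hy0 k)
  -- The orders used are `H + 1` and `H + 2`, because `H` may be 0 and the first claim needs a
  -- positive order.
  have hconv : OscSys.SolutionsConvergeToPeriodic f Ω T :=
    OscSys.SolutionsConvergeToPeriodic.of_consecutive (Nat.succ_pos H) hT
      (part1 _ (Nat.succ_pos H) (hV _ (Nat.le_succ H)))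
      (part1 _ (Nat.succ_pos _) (hV _ (by omega)))
  intro x hx hx0
  obtain ⟨y, hy, hyΩ, hyper, hlim⟩ := hconv x hx hx0
  exact ⟨y, hy, hyΩ, by simpa using hyper.nat_mul (n - 1), hlim⟩
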